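/- All Hilbert spaces are finite-dimensional; $k_B>0$; $S(\hat\rho)=-\mathrm{tr}[\hat\rho\log\hat\rho]$. For a Hamiltonian $\hat H$ and a temperature $T>0$ put $\beta=(k_BT)^{-1}$, $Z(\beta)=\mathrm{tr}[e^{-\beta\hat H}]$ and $F=-k_BT\log Z(\beta)$. An information thermodynamic process is the following. Let $S$ be a system, let $B_1,\dots,B_n$ be heat baths with Hamiltonians $\hat H^{B_m}$ and temperatures $T_m>0$, let $B$ be the set of all baths, and let $P$ be a probe. Let $\hat H^S_{\mathrm i},\hat H^S_{\mathrm f}$ be the initial and final Hamiltonians of $S$, and $T,T'>0$ its initial and final temperatures. The interaction between $S$ and $B$ is switched off at the initial and final times. Put $\beta=(k_BT)^{-1}$, $\beta'=(k_BT')^{-1}$, $\beta_m=(k_BT_m)^{-1}$. 1. The initial state is $\hat\rho_{\mathrm i}=\frac{e^{-\beta\hat H^S_{\mathrm i}}}{Z^S_{\mathrm i}(\beta)}\otimes\bigotimes_{m=1}^n\frac{e^{-\beta_m\hat H^{B_m}}}{Z^{B_m}(\beta_m)}$. A unitary $\hat U_{\mathrm{init}}$ on $SB$ gives $\hat\rho_1=\hat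 U_{\mathrm{init}}\hat\rho_{\mathrm i}\hat U_{\mathrm{init}}^\dagger$. Let $R$ be a reference system and $|\psi_{SBR}\rangle$ a pure state with $\mathrm{tr}_R|\psi_{SBR}\rangle\langle\psi_{SBR}|=\hat\rho_1$. 2. The probe, in a pure state $|0_P\rangle$, interacts with $S$ by a unitary $\hat U_{SP}$. This gives $|\psi_{PSBR}\rangle=(\hat U_{SP}\otimes\hat 1_B\otimes\hat 1_R)(|0_P\rangle\otimes|\psi_{SBR}\rangle)$ and $\hat\rho_{SBR}=\mathrm{tr}_P|\psi_{PSBR}\rangle\langle\psi_{PSBR}|$. 3. A projective measurement $\hat P_{(k)}=\sum_i|k,i_P\rangle\langle k,i_P|$ is made on $P$, where $\{|k,i_P\rangle\}_{k,i}$ is an orthonormal basis of $P$. The outcome $k$ has probability $p_k$ and leaves $SB$ in the state $\hat\rho_2^{(k)}$, where $p_k\hat\rho_2^{(k)}=\sum_i\mathrm{tr}_R|v_{ik}\rangle\langle v_{ik}|$ and $|v_{ik}\rangle=(\langle k,i_P|\otimes\hat 1_{SBR})|\psi_{PSBR}\rangle$. 4. Feedback unitaries $\hat U_{(k)}$ on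 $SB$ give $\hat\rho_3=\sum_kp_k\hat U_{(k)}\hat\rho_2^{(k)}\hat U_{(k)}^\dagger$, and a final unitary $\hat U_{\mathrm{fin}}$ on $SB$ gives $\hat\rho_{\mathrm f}=\hat U_{\mathrm{fin}}\hat\rho_3\hat U_{\mathrm{fin}}^\dagger$. The final state is regarded as an equilibrium state with temperature $T'$ of $S$ and $T_m$ of $B_m$, but need not be canonical; nothing else is assumed about it. For a state $\hat\rho$ of $SBR$, the entanglement of formation between $SB$ and $R$ is $$E_F^{SB\text{-}R}(\hat\rho)=\min_{\hat\rho=\sum_jq_j|\phi^j\rangle\langle\phi^j|}\ \sum_jq_j\,S\big(\mathrm{tr}_R|\phi^j\rangle\langle\phi^j|\big),$$ the minimum being over all finite decompositions into pure states with probabilities $q_j$. Put $\Delta E_F^{SB\text{-}R}=E_F^{SB\text{-}R}(\hat\rho_{SBR})-E_F^{SB\text{-}R}(|\psi_{SBR}\rangle\langle\psi_{SBR}|)$, and let $I_{\mathrm E}=-\Delta E_F^{SB\text{-}R}$ be the entanglement information. Put $U^S=\mathrm{tr}[\hat\rho_{\mathrm i}\hat H^S_{\mathrm i}]$, $U'^S=\mathrm{tr}[\hat\rho_{\mathrm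 f}\hat H^S_{\mathrm f}]$, $F^S=-k_BT\log Z^S_{\mathrm i}(\beta)$, $F'^S=-k_BT'\log Z^S_{\mathrm f}(\beta')$ and $Q_m=\mathrm{tr}[\hat H^{B_m}(\hat\rho_{\mathrm i}-\hat\rho_{\mathrm f})]$. **Theorem.** For every information thermodynamic process, $$\frac{U^S-F^S}{T}+\sum_{m=1}^n\frac{Q_m}{T_m}\le\frac{U'^S-F'^S}{T'}+k_BI_{\mathrm E}.$$ If the process is isothermal with a single heat bath ($n=1$ and $T'=T_1=T$), then the extracted work $W_{\mathrm{ext}}=\mathrm{tr}[\hat\rho_{\mathrm i}(\hat H^S_{\mathrm i}+\hat H^{B_1})]-\mathrm{tr}[\hat\rho_{\mathrm f}(\hat H^S_{\mathrm f}+\hat H^{B_1})]$ satisfies, with $\Delta F=F'^S-F^S$, $$W_{\mathrm{ext}}\le-\Delta F+k_BTI_{\mathrm E}=-\Delta F-k_BT\,\Delta E_F^{SB\text{-}R}.$$ -/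

import Mathlib

open scoped Kronecker

namespace InfoThermo

noncomputable section

/-! ### States of finite-dimensional quantum systems

A quantum system whose Hilbert space is `ℂ^X` is represented by its finite index type `X`;
a composite system is represented by the product of the index types. -/

/-- The rank-one operator `|v⟩⟨v|`. -/
def ketbra {X : Type*} (v : X → ℂ) : Matrix X X ℂ :=
  Matrix.vecMulVec v (star v)

/-- Partial trace over the second tensor factor. -/
def traceSnd {X Y : Type*} [Fintype Y] (M : Matrix (X × Y) (X × Y) ℂ) : Matrix X X ℂ :=
  Matrix.of fun x x' => ∑ y, M (x, y) (x', y)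

/-- Tensor product of a finite family of operators. -/
def tensorFamily {ι : Type*} [Fintype ι] {X : ι → Type*}
    (A : ∀ m, Matrix (X m) (X m) ℂ) : Matrix (∀ m, X m) (∀ m, X m) ℂ :=
  Matrix.of fun x y => ∏ m, A m (x m) (y m)

/-- Von Neumann entropy `-tr[ρ log ρ]`. -/
def entropy {X : Type*} [Fintype X] [DecidableEq X] (ρ : Matrix X X ℂ) : ℝ :=
  -(ρ * cfc Real.log ρ).trace.re

/-- Energy `tr[ρ H]`. -/
def energy {X : Type*} [Fintype X] (ρ H : Matrix X X ℂ) : ℝ :=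
  (ρ * H).trace.re

/-- The operator `exp(-H / (kB T))`. -/
def boltzmann {X : Type*} [Fintype X] [DecidableEq X] (kB T : ℝ) (H : Matrix X X ℂ) :
    Matrix X X ℂ :=
  NormedSpace.exp ((((-(kB * T)⁻¹ : ℝ)) : ℂ) • H)

/-- The partition function `Z = tr[exp(-H / (kB T))]`. -/
def partitionFn {X : Type*} [Fintype X] [DecidableEq X] (kB T : ℝ) (H : Matrix X X ℂ) : ℝ :=
  (boltzmann kB T H).trace.re

/-- The canonical state `exp(-H / (kB T)) / Z`. -/
def canonicalState {X : Type*} [Fintype X] [DecidableEq X] (kB T : ℝ) (H : Matrix X X ℂ) :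
    Matrix X X ℂ :=
  (((partitionFn kB T H)⁻¹ : ℝ) : ℂ) • boltzmann kB T H

/-- The Helmholtz free energy `-kB T log Z`. -/
def freeEnergy {X : Type*} [Fintype X] [DecidableEq X] (kB T : ℝ) (H : Matrix X X ℂ) : ℝ :=
  -(kB * T * Real.log (partitionFn kB T H))

/-! ### Entanglement of formation -/

/-- Entanglement entropy of a pure state `|φ⟩` of the bipartite system `X Y`. -/
def entanglementEntropy {X Y : Type*} [Fintype X] [DecidableEq X] [Fintype Y]
    (φ : X × Y → ℂ) : ℝ :=
  entropy (traceSnd (ketbra φ))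

/-- Entanglement of formation between `X` and `Y`: the least value of
`∑ j, q j * E(φ j)` over all decompositions `ρ = ∑ j, q j |φ j⟩⟨φ j|` into normalized pure
states with probabilities `q j`. -/
def entanglementOfFormation {X Y : Type*} [Fintype X] [DecidableEq X] [Fintype Y]
    (ρ : Matrix (X × Y) (X × Y) ℂ) : ℝ :=
  sInf {e : ℝ | ∃ (N : ℕ) (q : Fin N → ℝ) (φ : Fin N → X × Y → ℂ),
    (∀ j, 0 ≤ q j) ∧ (∑ j, q j = 1) ∧ (∀ j, star (φ j) ⬝ᵥ φ j = 1) ∧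
    ρ = ∑ j, (q j : ℂ) • ketbra (φ j) ∧
    e = ∑ j, q j * entanglementEntropy (φ j)}

/-! ### Information thermodynamic processes -/

/-- The initial state of `S B`: the tensor product of the canonical states of the system and of
each of the baths, at their respective temperatures. -/
def initialState {n : ℕ} {S : Type*} {B : Fin n → Type*} [Fintype S] [DecidableEq S]
    [∀ m, Fintype (B m)] [∀ m, DecidableEq (B m)] (kB T : ℝ) (Tb : Fin n → ℝ)
    (HS : Matrix S S ℂ) (HB : ∀ m, Matrix (B m) (B m) ℂ) :
    Matrix (S × ∀ m, B m) (S × ∀ m, B m) ℂ :=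
  canonicalState kB T HS ⊗ₖ tensorFamily fun m => canonicalState kB (Tb m) (HB m)

/-- An information thermodynamic process on a system `S`, heat baths `B 0, …, B (n-1)`,
a probe `P` and a reference system `R`. The measurement outcomes are the elements `k` of `K`,
and `L k` indexes the basis vectors that span the eigenspace of the outcome `k`. -/
structure InfoProcess (n : ℕ) (S P R : Type*) (B : Fin n → Type*) (K : Type*) (L : K → Type*)
    [Fintype S] [DecidableEq S] [Fintype P] [DecidableEq P] [Fintype R] [DecidableEq R]
    [∀ m, Fintype (B m)] [∀ m, DecidableEq (B m)] [Fintype K] [∀ k, Fintype (L k)] where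
  /-- The Boltzmann constant. -/
  kB : ℝ
  kB_pos : 0 < kB
  /-- Initial temperature of the system. -/
  T : ℝ
  T_pos : 0 < T
  /-- Final temperature of the system. -/
  T' : ℝ
  T'_pos : 0 < T'
  /-- Temperatures of the baths. -/
  Tb : Fin n → ℝ
  Tb_pos : ∀ m, 0 < Tb m
  /-- Hamiltonian of the system at the initial time. -/
  HSi : Matrix S S ℂ
  HSi_herm : HSi.IsHermitian
  /-- Hamiltonian of the system at the final time. -/
  HSf : Matrix S S ℂ
  HSf_herm : HSf.IsHermitian
  /-- Hamiltonians of the baths. -/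
  HB : ∀ m, Matrix (B m) (B m) ℂ
  HB_herm : ∀ m, (HB m).IsHermitian
  /-- The thermodynamic operation before the measurement. -/
  Uinit : Matrix.unitaryGroup (S × ∀ m, B m) ℂ
  /-- The purification, with the reference system, of the state of `S B` before the
  measurement. -/
  ψ : (S × ∀ m, B m) × R → ℂ
  purifies : traceSnd (ketbra ψ) =
    (Uinit : Matrix (S × ∀ m, B m) (S × ∀ m, B m) ℂ) * initialState kB T Tb HSi HB *
      (Uinit : Matrix (S × ∀ m, B m) (S × ∀ m, B m) ℂ).conjTranspose
  /-- The initial state of the probe. -/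
  probe : P → ℂ
  probe_unit : star probe ⬝ᵥ probe = 1
  /-- The interaction between the probe and the system. -/
  USP : Matrix.unitaryGroup (P × S) ℂ
  /-- The orthonormal basis `|k, i⟩` of the probe that defines the projective measurement
  with the projections `∑ i, |k, i⟩⟨k, i|`. -/
  basis : OrthonormalBasis (Σ k, L k) ℂ (EuclideanSpace ℂ P)
  /-- The feedback unitaries. -/
  Ufb : K → Matrix.unitaryGroup (S × ∀ m, B m) ℂ
  /-- The thermodynamic operation after the feedback. -/
  Ufin : Matrix.unitaryGroup (S × ∀ m, B m) ℂ

namespace InfoProcess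

variable {n : ℕ} {S P R : Type*} {B : Fin n → Type*} {K : Type*} {L : K → Type*}
  [Fintype S] [DecidableEq S] [Fintype P] [DecidableEq P] [Fintype R] [DecidableEq R]
  [∀ m, Fintype (B m)] [∀ m, DecidableEq (B m)] [Fintype K] [∀ k, Fintype (L k)]

/-- Initial state `ρ_i` of `S B`. -/
def rhoI (pr : InfoProcess n S P R B K L) : Matrix (S × ∀ m, B m) (S × ∀ m, B m) ℂ :=
  initialState pr.kB pr.T pr.Tb pr.HSi pr.HB

/-- State of the probe, the system, the baths and the reference after the interaction:
`(U_SP ⊗ 1_B ⊗ 1_R) (|0_P⟩ ⊗ |ψ⟩)`. -/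
def psiPSBR (pr : InfoProcess n S P R B K L) : ((P × S) × ∀ m, B m) × R → ℂ :=
  (((pr.USP : Matrix (P × S) (P × S) ℂ) ⊗ₖ (1 : Matrix (∀ m, B m) (∀ m, B m) ℂ)) ⊗ₖ
    (1 : Matrix R R ℂ)).mulVec
      fun x => pr.probe x.1.1.1 * pr.ψ ((x.1.1.2, x.1.2), x.2)

/-- State of `S B R` after the interaction: the probe is traced out. -/
def rhoSBR (pr : InfoProcess n S P R B K L) :
    Matrix ((S × ∀ m, B m) × R) ((S × ∀ m, B m) × R) ℂ :=
  Matrix.of fun x y => ∑ p : P,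
    ketbra pr.psiPSBR (((p, x.1.1), x.1.2), x.2) (((p, y.1.1), y.1.2), y.2)

/-- The (unnormalized) vector `(⟨k, i| ⊗ 1_SBR) |ψ_PSBR⟩`. -/
def postVector (pr : InfoProcess n S P R B K L) (k : K) (i : L k) : (S × ∀ m, B m) × R → ℂ :=
  fun x => ∑ p : P, star (pr.basis ⟨k, i⟩ p) * pr.psiPSBR (((p, x.1.1), x.1.2), x.2)

/-- The state of `S B` after the outcome `k`, weighted with the probability of `k`. -/
def weightedPostState (pr : InfoProcess n S P R B K L) (k : K) :
    Matrix (S × ∀ m, B m) (S × ∀ m, B m) ℂ :=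
  traceSnd (∑ i : L k, ketbra (pr.postVector k i))

/-- State of `S B` after the feedback. -/
def rho3 (pr : InfoProcess n S P R B K L) : Matrix (S × ∀ m, B m) (S × ∀ m, B m) ℂ :=
  ∑ k : K, (pr.Ufb k : Matrix (S × ∀ m, B m) (S × ∀ m, B m) ℂ) * pr.weightedPostState k *
    (pr.Ufb k : Matrix (S × ∀ m, B m) (S × ∀ m, B m) ℂ).conjTranspose

/-- Final state `ρ_f` of `S B`. -/
def rhoF (pr : InfoProcess n S P R B K L) : Matrix (S × ∀ m, B m) (S × ∀ m, B m) ℂ :=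
  (pr.Ufin : Matrix (S × ∀ m, B m) (S × ∀ m, B m) ℂ) * pr.rho3 *
    (pr.Ufin : Matrix (S × ∀ m, B m) (S × ∀ m, B m) ℂ).conjTranspose

/-- An operator of the system, as an operator of `S B`. -/
def onSystem (_pr : InfoProcess n S P R B K L) (H : Matrix S S ℂ) :
    Matrix (S × ∀ m, B m) (S × ∀ m, B m) ℂ :=
  H ⊗ₖ (1 : Matrix (∀ m, B m) (∀ m, B m) ℂ)

/-- The Hamiltonian of the bath `m`, as an operator of `S B`. -/
def bathHamiltonian (pr : InfoProcess n S P R B K L) (m : Fin n) :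
    Matrix (S × ∀ m, B m) (S × ∀ m, B m) ℂ :=
  (1 : Matrix S S ℂ) ⊗ₖ
    tensorFamily (Function.update (fun l => (1 : Matrix (B l) (B l) ℂ)) m (pr.HB m))

/-- Energy `U^S` of the system at the initial time. -/
def Ui (pr : InfoProcess n S P R B K L) : ℝ := energy pr.rhoI (pr.onSystem pr.HSi)

/-- Energy `U'^S` of the system at the final time. -/
def Uf (pr : InfoProcess n S P R B K L) : ℝ := energy pr.rhoF (pr.onSystem pr.HSf)

/-- Free energy `F^S` of the system at the initial time. -/
def Fi (pr : InfoProcess n S P R B K L) : ℝ := freeEnergy pr.kB pr.T pr.HSi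

/-- Free energy `F'^S` of the system at the final time. -/
def Ff (pr : InfoProcess n S P R B K L) : ℝ := freeEnergy pr.kB pr.T' pr.HSf

/-- Heat `Q_m = tr[H^{B_m} (ρ_i - ρ_f)]` that the bath `m` releases. -/
def Q (pr : InfoProcess n S P R B K L) (m : Fin n) : ℝ :=
  energy (pr.rhoI - pr.rhoF) (pr.bathHamiltonian m)

/-- Extracted work: the decrease of the total energy of the system and the baths, whose
interaction is switched off at the initial and at the final time. -/
def Wext (pr : InfoProcess n S P R B K L) : ℝ :=
  energy pr.rhoI (pr.onSystem pr.HSi + ∑ m, pr.bathHamiltonian m) -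
    energy pr.rhoF (pr.onSystem pr.HSf + ∑ m, pr.bathHamiltonian m)

/-- Change `ΔE_F` of the entanglement of formation between `S B` and `R` by the interaction
with the probe: the value after minus the value before. -/
def deltaEF (pr : InfoProcess n S P R B K L) : ℝ :=
  entanglementOfFormation pr.rhoSBR - entanglementOfFormation (ketbra pr.ψ)

/-- Entanglement information `I_E`. -/
def IE (pr : InfoProcess n S P R B K L) : ℝ :=
  entanglementOfFormation (ketbra pr.ψ) - entanglementOfFormation pr.rhoSBR

end InfoProcess

end

end InfoThermo

/-! The inequality compares von Neumann entropies of `S B` at the two ends of the process.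

Initially `S B` is in a product of canonical states, so its entropy is the sum of
`(U - F) / (kB T)` over the system and the baths (`InfoProcess.entropy_rhoI_eq`). For the final
state, which is arbitrary, Klein's inequality relative to the product of the canonical states at
the final temperatures says that the corresponding sum is at least the entropy
(`InfoProcess.entropy_rhoF_le`). The free energies of the baths cancel, and the second law reduces
to `S(ρ_i) - S(ρ_f) ≤ I_E` (`InfoProcess.entropy_sub_entropy_le_IE`).

This last inequality has two halves. A pure state has only trivial decompositions, so its
entanglement of formation is at least the entropy of its marginal, which is `S(ρ_i)`. After the
interaction with the probe, the vectors `(⟨k, i| ⊗ 1) |ψ_PSBR⟩` of the measured basis are one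
pure-state decomposition of the state of `S B R`. Its average entanglement entropy bounds the
entanglement of formation from above. The final state is a mixture of the marginals of the same
decomposition, each rotated by a feedback unitary, so by concavity and unitary invariance of the
entropy that average is at most `S(ρ_f)`.

All entropy inequalities rest on `entropy_le_sum_negMulLog_diag`: passing to the diagonal in an
orthonormal basis does not decrease the entropy. Combined with the eigenbasis of a mixture it gives
concavity, and with the eigenbasis of a canonical state and the classical Gibbs inequality it gives
Klein's inequality. -/

namespace InfoThermo

open Matrix

open scoped ComplexOrder

/-- The Hermitian matrix `U diag(d) U†` with the real eigenvalues `d` and the eigenbasis formed by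
the columns of `U`. -/
noncomputable def spectralMatrix {X : Type*} [Fintype X] [DecidableEq X]
    (U : unitaryGroup X ℂ) (d : X → ℝ) : Matrix X X ℂ :=
  (U : Matrix X X ℂ) * diagonal (fun x => (d x : ℂ)) * (U : Matrix X X ℂ)ᴴ

/-! ### Matrices with a given eigenbasis -/

section Spectral

variable {X : Type*} [Fintype X] [DecidableEq X]

theorem conjTranspose_mul_self_of_unitary (U : unitaryGroup X ℂ) :
    (U : Matrix X X ℂ)ᴴ * (U : Matrix X X ℂ) = 1 :=
  Unitary.coe_star_mul_self U

theorem self_mul_conjTranspose_of_unitary (U : unitaryGroup X ℂ) :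
    (U : Matrix X X ℂ) * (U : Matrix X X ℂ)ᴴ = 1 :=
  Unitary.coe_mul_star_self U

theorem exists_eq_spectralMatrix {A : Matrix X X ℂ} (hA : A.IsHermitian) :
    ∃ (U : unitaryGroup X ℂ) (d : X → ℝ), A = spectralMatrix U d :=
  ⟨hA.eigenvectorUnitary, hA.eigenvalues, hA.spectral_theorem⟩

theorem exists_eq_spectralMatrix_of_posSemidef {A : Matrix X X ℂ} (hA : A.PosSemidef) :
    ∃ (U : unitaryGroup X ℂ) (d : X → ℝ), (∀ x, 0 ≤ d x) ∧ A = spectralMatrix U d :=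
  ⟨hA.1.eigenvectorUnitary, hA.1.eigenvalues, hA.eigenvalues_nonneg, hA.1.spectral_theorem⟩

theorem spectralMatrix_isHermitian (U : unitaryGroup X ℂ) (d : X → ℝ) :
    (spectralMatrix U d).IsHermitian := by
  rw [IsHermitian, spectralMatrix, conjTranspose_mul, conjTranspose_mul,
    conjTranspose_conjTranspose,
    diagonal_conjTranspose, mul_assoc]
  congr 3
  ext x
  simp

theorem trace_spectralMatrix (U : unitaryGroup X ℂ) (d : X → ℝ) :
    (spectralMatrix U d).trace = ((∑ x, d x : ℝ) : ℂ) := by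
  rw [spectralMatrix, trace_mul_comm, ← mul_assoc, conjTranspose_mul_self_of_unitary, one_mul,
    trace_diagonal]
  push_cast
  rfl

theorem unitary_conj_spectralMatrix (V U : unitaryGroup X ℂ) (d : X → ℝ) :
    (V : Matrix X X ℂ) * spectralMatrix U d * (V : Matrix X X ℂ)ᴴ = spectralMatrix (V * U) d := by
  simp [spectralMatrix, mul_assoc]

theorem spectralMatrix_mul (U : unitaryGroup X ℂ) (d e : X → ℝ) :
    spectralMatrix U d * spectralMatrix U e = spectralMatrix U (fun x => d x * e x) := by
  calc _ = (U : Matrix X X ℂ) * diagonal (fun x => (d x : ℂ)) *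
      ((U : Matrix X X ℂ)ᴴ * (U : Matrix X X ℂ)) * diagonal (fun x => (e x : ℂ)) *
      (U : Matrix X X ℂ)ᴴ := by simp only [spectralMatrix, mul_assoc]
    _ = _ := by
      rw [conjTranspose_mul_self_of_unitary, mul_one, mul_assoc (U : Matrix X X ℂ),
        diagonal_mul_diagonal]
      simp [spectralMatrix]

theorem spectralMatrix_add (U : unitaryGroup X ℂ) (d e : X → ℝ) :
    spectralMatrix U d + spectralMatrix U e = spectralMatrix U (fun x => d x + e x) := by
  simp only [spectralMatrix, ← mul_add, ← add_mul, diagonal_add]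
  simp

theorem spectralMatrix_smul (U : unitaryGroup X ℂ) (c : ℝ) (d : X → ℝ) :
    (c : ℂ) • spectralMatrix U d = spectralMatrix U (fun x => c * d x) := by
  rw [spectralMatrix, ← smul_mul_assoc, ← mul_smul_comm, ← diagonal_smul, spectralMatrix]
  congr 3
  ext x
  simp

theorem spectralMatrix_const (U : unitaryGroup X ℂ) (c : ℝ) :
    spectralMatrix U (fun _ => c) = (c : ℂ) • 1 := by
  rw [spectralMatrix, ← smul_one_eq_diagonal, mul_smul_comm, smul_mul_assoc, mul_one,
    self_mul_conjTranspose_of_unitary]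

theorem spectralMatrix_zero (U : unitaryGroup X ℂ) :
    spectralMatrix U (fun _ => 0) = 0 := by
  simp [spectralMatrix_const]

theorem spectralMatrix_sum {ι : Type*} (s : Finset ι) (U : unitaryGroup X ℂ) (d : ι → X → ℝ) :
    ∑ i ∈ s, spectralMatrix U (d i) = spectralMatrix U (fun x => ∑ i ∈ s, d i x) := by
  classical
  induction s using Finset.induction_on with
  | empty => simp [spectralMatrix_zero]
  | insert i s hi ih => simp [Finset.sum_insert hi, ih, spectralMatrix_add]

theorem energy_spectralMatrix (ρ : Matrix X X ℂ) (U : unitaryGroup X ℂ) (d : X → ℝ) :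
    energy ρ (spectralMatrix U d) =
      ∑ x, d x * (((U : Matrix X X ℂ)ᴴ * ρ * (U : Matrix X X ℂ)) x x).re := by
  rw [energy, spectralMatrix, ← mul_assoc, trace_mul_comm, ← mul_assoc, ← mul_assoc, trace,
    Complex.re_sum]
  refine Finset.sum_congr rfl fun x _ => ?_
  rw [diag_apply, mul_diagonal, mul_comm, Complex.re_ofReal_mul]

/-- The functional calculus acts on the eigenvalues of any diagonalization, not only on that of
the spectral theorem. -/
theorem cfc_spectralMatrix (f : ℝ → ℝ) (U : unitaryGroup X ℂ) (d : X → ℝ) :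
    cfc f (spectralMatrix U d) = spectralMatrix U (fun x => f (d x)) := by
  have hA := spectralMatrix_isHermitian U d
  have hspec : spectralMatrix U d = spectralMatrix hA.eigenvectorUnitary hA.eigenvalues :=
    hA.spectral_theorem
  have hcfc : cfc f (spectralMatrix U d) =
      spectralMatrix hA.eigenvectorUnitary (fun x => f (hA.eigenvalues x)) := hA.cfc_eq f
  rw [hcfc]
  generalize hA.eigenvectorUnitary = V at hspec ⊢
  generalize hA.eigenvalues = e at hspec ⊢
  -- `U†V` intertwines the two diagonal matrices, so its entries vanish where `d x ≠ e y`.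
  have hint : diagonal (fun x => (d x : ℂ)) * ((U : Matrix X X ℂ)ᴴ * (V : Matrix X X ℂ)) =
      ((U : Matrix X X ℂ)ᴴ * (V : Matrix X X ℂ)) * diagonal (fun x => (e x : ℂ)) := by
    calc _ = (U : Matrix X X ℂ)ᴴ * spectralMatrix U d * (V : Matrix X X ℂ) := by
          simp only [spectralMatrix, ← mul_assoc]
          rw [conjTranspose_mul_self_of_unitary, one_mul]
      _ = _ := by
          rw [hspec, spectralMatrix, mul_assoc, mul_assoc, conjTranspose_mul_self_of_unitary,
            mul_one, mul_assoc]
  have hint' : diagonal (fun x => (f (d x) : ℂ)) * ((U : Matrix X X ℂ)ᴴ * (V : Matrix X X ℂ)) =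
      ((U : Matrix X X ℂ)ᴴ * (V : Matrix X X ℂ)) * diagonal (fun x => (f (e x) : ℂ)) := by
    ext x y
    have h := congrFun (congrFun hint x) y
    rw [diagonal_mul, mul_diagonal] at h ⊢
    by_cases hxy : d x = e y
    · rw [hxy, mul_comm]
    · have h0 : ((U : Matrix X X ℂ)ᴴ * (V : Matrix X X ℂ)) x y = 0 := by
        by_contra hne
        rw [mul_comm] at h
        exact hxy (by exact_mod_cast mul_left_cancel₀ hne h)
      simp [h0]
  calc spectralMatrix V (fun x => f (e x))
      = (U : Matrix X X ℂ) * (((U : Matrix X X ℂ)ᴴ * (V : Matrix X X ℂ)) *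
          diagonal (fun x => (f (e x) : ℂ))) * (V : Matrix X X ℂ)ᴴ := by
        rw [← mul_assoc, ← mul_assoc, self_mul_conjTranspose_of_unitary, one_mul, spectralMatrix]
    _ = spectralMatrix U (fun x => f (d x)) := by
        rw [← hint', mul_assoc, mul_assoc, mul_assoc, self_mul_conjTranspose_of_unitary, mul_one,
          ← mul_assoc, spectralMatrix]

end Spectral

/-! ### Von Neumann entropy -/

section Entropy

variable {X : Type*} [Fintype X] [DecidableEq X]

theorem entropy_spectralMatrix (U : unitaryGroup X ℂ) (d : X → ℝ) :
    entropy (spectralMatrix U d) = ∑ x, Real.negMulLog (d x) := by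
  rw [entropy, cfc_spectralMatrix, spectralMatrix_mul, trace_spectralMatrix, Complex.ofReal_re,
    ← Finset.sum_neg_distrib]
  simp [Real.negMulLog]

theorem entropy_unitary_conj {ρ : Matrix X X ℂ} (hρ : ρ.IsHermitian) (V : unitaryGroup X ℂ) :
    entropy ((V : Matrix X X ℂ) * ρ * (V : Matrix X X ℂ)ᴴ) = entropy ρ := by
  obtain ⟨U, d, rfl⟩ := exists_eq_spectralMatrix hρ
  rw [unitary_conj_spectralMatrix, entropy_spectralMatrix, entropy_spectralMatrix]

theorem entropy_nonneg {ρ : Matrix X X ℂ} (hρ : ρ.PosSemidef) (htr : ρ.trace = 1) :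
    0 ≤ entropy ρ := by
  obtain ⟨U, d, hd, rfl⟩ := exists_eq_spectralMatrix_of_posSemidef hρ
  rw [entropy_spectralMatrix]
  have hsum : ∑ x, d x = 1 := by
    rw [trace_spectralMatrix] at htr
    exact_mod_cast htr
  refine Finset.sum_nonneg fun x _ => Real.negMulLog_nonneg (hd x) ?_
  rw [← hsum]
  exact Finset.single_le_sum (fun y _ => hd y) (Finset.mem_univ x)

theorem sum_normSq_row_of_unitary (W : unitaryGroup X ℂ) (x : X) :
    ∑ y, Complex.normSq ((W : Matrix X X ℂ) x y) = 1 := by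
  have h := congrFun (congrFun (self_mul_conjTranspose_of_unitary W) x) x
  rw [mul_apply, one_apply_eq] at h
  have h' : ((∑ y, Complex.normSq ((W : Matrix X X ℂ) x y) : ℝ) : ℂ) = 1 := by
    rw [← h]
    push_cast
    exact Finset.sum_congr rfl fun y _ => (Complex.mul_conj _).symm
  exact_mod_cast h'

theorem sum_normSq_col_of_unitary (W : unitaryGroup X ℂ) (y : X) :
    ∑ x, Complex.normSq ((W : Matrix X X ℂ) x y) = 1 := by
  have h := sum_normSq_row_of_unitary (star W) y
  simpa [star_apply] using h

theorem spectralMatrix_diag_re (W : unitaryGroup X ℂ) (d : X → ℝ) (x : X) :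
    (spectralMatrix W d x x).re = ∑ y, Complex.normSq ((W : Matrix X X ℂ) x y) * d y := by
  rw [spectralMatrix, mul_apply, Complex.re_sum]
  refine Finset.sum_congr rfl fun y _ => ?_
  rw [mul_diagonal, conjTranspose_apply, mul_right_comm, Complex.star_def, Complex.mul_conj,
    ← Complex.ofReal_mul, Complex.ofReal_re]

/-- Dephasing in an orthonormal basis does not decrease the entropy: the diagonal is the image of
the spectrum under a doubly stochastic matrix, and `negMulLog` is concave. -/
theorem entropy_le_sum_negMulLog_diag {ρ : Matrix X X ℂ} (hρ : ρ.PosSemidef)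
    (U : unitaryGroup X ℂ) :
    entropy ρ ≤
      ∑ x, Real.negMulLog (((U : Matrix X X ℂ)ᴴ * ρ * (U : Matrix X X ℂ)) x x).re := by
  obtain ⟨V, d, hd, rfl⟩ := exists_eq_spectralMatrix_of_posSemidef hρ
  have hconj : (U : Matrix X X ℂ)ᴴ * spectralMatrix V d * (U : Matrix X X ℂ) =
      spectralMatrix (star U * V) d := by
    rw [← unitary_conj_spectralMatrix]
    simp [star_eq_conjTranspose]
  rw [hconj, entropy_spectralMatrix]
  generalize star U * V = W
  calc ∑ y, Real.negMulLog (d y)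
      = ∑ y, (∑ x, Complex.normSq ((W : Matrix X X ℂ) x y)) * Real.negMulLog (d y) := by
        simp [sum_normSq_col_of_unitary]
    _ = ∑ x, ∑ y, Complex.normSq ((W : Matrix X X ℂ) x y) • Real.negMulLog (d y) := by
        simp_rw [Finset.sum_mul, smul_eq_mul]
        exact Finset.sum_comm
    _ ≤ _ := by
        refine Finset.sum_le_sum fun x _ => ?_
        rw [spectralMatrix_diag_re]
        exact Real.concaveOn_negMulLog.le_map_sum (fun y _ => Complex.normSq_nonneg _)
          (sum_normSq_row_of_unitary W x) (fun y _ => hd y)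

theorem re_unitary_conj_diag_nonneg {ρ : Matrix X X ℂ} (hρ : ρ.PosSemidef)
    (U : unitaryGroup X ℂ) (x : X) :
    0 ≤ (((U : Matrix X X ℂ)ᴴ * ρ * (U : Matrix X X ℂ)) x x).re :=
  (Complex.nonneg_iff.mp ((hρ.conjTranspose_mul_mul_same (U : Matrix X X ℂ)).diag_nonneg)).1

/-- Concavity of the von Neumann entropy. In an eigenbasis of the mixture it reduces to the
concavity of `negMulLog` on each diagonal entry, followed by dephasing of each component; this
also covers singular states. -/
theorem sum_mul_entropy_le_entropy_sum {ι : Type*} (s : Finset ι) {q : ι → ℝ}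
    {ρ : ι → Matrix X X ℂ} (hq : ∀ j ∈ s, 0 ≤ q j) (hq1 : ∑ j ∈ s, q j = 1)
    (hρ : ∀ j, (ρ j).PosSemidef) :
    ∑ j ∈ s, q j * entropy (ρ j) ≤ entropy (∑ j ∈ s, (q j : ℂ) • ρ j) := by
  have hσ : (∑ j ∈ s, (q j : ℂ) • ρ j).IsHermitian :=
    (posSemidef_sum s fun j hj =>
      (hρ j).smul (show (0 : ℂ) ≤ (q j : ℂ) by exact_mod_cast hq j hj)).1
  obtain ⟨U, d, hU⟩ := exists_eq_spectralMatrix hσ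
  have hd : ∀ x, d x = ∑ j ∈ s,
      q j • (((U : Matrix X X ℂ)ᴴ * ρ j * (U : Matrix X X ℂ)) x x).re := by
    intro x
    have h1 : (U : Matrix X X ℂ)ᴴ * spectralMatrix U d * (U : Matrix X X ℂ) =
        diagonal (fun x => (d x : ℂ)) := by
      rw [spectralMatrix, mul_assoc, mul_assoc, conjTranspose_mul_self_of_unitary, mul_one,
        ← mul_assoc, conjTranspose_mul_self_of_unitary, one_mul]
    rw [← hU, Finset.mul_sum, Finset.sum_mul] at h1
    have h2 := congrArg Complex.re (congrFun (congrFun h1 x) x)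
    rw [diagonal_apply_eq, Complex.ofReal_re, Matrix.sum_apply, Complex.re_sum] at h2
    rw [← h2]
    refine Finset.sum_congr rfl fun j _ => ?_
    rw [mul_smul_comm, smul_mul_assoc, Matrix.smul_apply, smul_eq_mul, smul_eq_mul,
      Complex.re_ofReal_mul]
  rw [hU, entropy_spectralMatrix]
  calc ∑ j ∈ s, q j * entropy (ρ j)
      ≤ ∑ j ∈ s, q j * ∑ x,
          Real.negMulLog (((U : Matrix X X ℂ)ᴴ * ρ j * (U : Matrix X X ℂ)) x x).re :=
        Finset.sum_le_sum fun j hj =>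
          mul_le_mul_of_nonneg_left (entropy_le_sum_negMulLog_diag (hρ j) U) (hq j hj)
    _ = ∑ x, ∑ j ∈ s, q j •
          Real.negMulLog (((U : Matrix X X ℂ)ᴴ * ρ j * (U : Matrix X X ℂ)) x x).re := by
        simp_rw [Finset.mul_sum, smul_eq_mul]
        exact Finset.sum_comm
    _ ≤ ∑ x, Real.negMulLog (d x) := by
        refine Finset.sum_le_sum fun x _ => ?_
        rw [hd x]
        exact Real.concaveOn_negMulLog.le_map_sum hq hq1
          (fun j _ => re_unitary_conj_diag_nonneg (hρ j) U x)

/-- Gibbs' inequality, one term. -/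
theorem negMulLog_le_of_pos {r p : ℝ} (hr : 0 ≤ r) (hp : 0 < p) :
    Real.negMulLog r ≤ -Real.log p * r + (p - r) := by
  rcases hr.eq_or_lt with rfl | hr
  · simpa using hp.le
  · have h := Real.log_le_sub_one_of_pos (div_pos hp hr)
    rw [Real.log_div hp.ne' hr.ne'] at h
    have h2 := mul_le_mul_of_nonneg_left h hr.le
    have h3 : r * (p / r - 1) = p - r := by field_simp
    rw [h3] at h2
    simp only [Real.negMulLog]
    linarith

/-- Klein's inequality `S(ρ) ≤ -tr[ρ log σ]` for a nonsingular state `σ = U diag(p) U†`. -/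
theorem entropy_le_energy_neg_log {ρ : Matrix X X ℂ} (hρ : ρ.PosSemidef) (htr : ρ.trace = 1)
    (U : unitaryGroup X ℂ) {p : X → ℝ} (hp : ∀ x, 0 < p x) (hp1 : ∑ x, p x = 1) :
    entropy ρ ≤ energy ρ (spectralMatrix U fun x => -Real.log (p x)) := by
  have hsum : ∑ x, (((U : Matrix X X ℂ)ᴴ * ρ * (U : Matrix X X ℂ)) x x).re = 1 := by
    have h : ((U : Matrix X X ℂ)ᴴ * ρ * (U : Matrix X X ℂ)).trace = 1 := by
      rw [trace_mul_comm, ← mul_assoc, self_mul_conjTranspose_of_unitary, one_mul, htr]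
    simpa [trace] using congrArg Complex.re h
  refine (entropy_le_sum_negMulLog_diag hρ U).trans ?_
  rw [energy_spectralMatrix]
  calc _ ≤ ∑ x, (-Real.log (p x) * (((U : Matrix X X ℂ)ᴴ * ρ * (U : Matrix X X ℂ)) x x).re +
        (p x - (((U : Matrix X X ℂ)ᴴ * ρ * (U : Matrix X X ℂ)) x x).re)) :=
        Finset.sum_le_sum fun x _ => negMulLog_le_of_pos (re_unitary_conj_diag_nonneg hρ U x) (hp x)
    _ = _ := by rw [Finset.sum_add_distrib, Finset.sum_sub_distrib, hp1, hsum, sub_self, add_zero]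

theorem entropy_spectralMatrix_eq_energy_neg_log (U : unitaryGroup X ℂ) (p : X → ℝ) :
    entropy (spectralMatrix U p) =
      energy (spectralMatrix U p) (spectralMatrix U fun x => -Real.log (p x)) := by
  rw [entropy_spectralMatrix, energy, spectralMatrix_mul, trace_spectralMatrix, Complex.ofReal_re]
  simp [Real.negMulLog]

end Entropy

/-! ### Tensor products of finite families -/

section TensorFamily

variable {ι : Type*} [Fintype ι] {X : ι → Type*}

theorem tensorFamily_mul [DecidableEq ι] [∀ m, Fintype (X m)]
    (A C : ∀ m, Matrix (X m) (X m) ℂ) :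
    tensorFamily A * tensorFamily C = tensorFamily fun m => A m * C m := by
  ext x y
  simp only [tensorFamily, mul_apply, of_apply, ← Finset.prod_mul_distrib]
  exact (Fintype.prod_sum fun m z => A m (x m) z * C m z (y m)).symm

theorem tensorFamily_conjTranspose (A : ∀ m, Matrix (X m) (X m) ℂ) :
    (tensorFamily A)ᴴ = tensorFamily fun m => (A m)ᴴ := by
  ext x y
  simp [tensorFamily, conjTranspose_apply]

theorem tensorFamily_diagonal [∀ m, DecidableEq (X m)] [DecidableEq (∀ m, X m)]
    (d : ∀ m, X m → ℂ) :
    tensorFamily (fun m => diagonal (d m)) = diagonal fun x => ∏ m, d m (x m) := by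
  ext x y
  rw [tensorFamily, of_apply]
  by_cases h : x = y
  · subst h
    simp
  · obtain ⟨m, hm⟩ := Function.ne_iff.mp h
    rw [diagonal_apply_ne _ h]
    exact Finset.prod_eq_zero (Finset.mem_univ m) (diagonal_apply_ne _ hm)

theorem tensorFamily_one [∀ m, DecidableEq (X m)] [DecidableEq (∀ m, X m)] :
    tensorFamily (fun m => (1 : Matrix (X m) (X m) ℂ)) = 1 := by
  simpa [← diagonal_one] using tensorFamily_diagonal fun (m : ι) (_ : X m) => (1 : ℂ)

variable [DecidableEq ι] [∀ m, Fintype (X m)] [∀ m, DecidableEq (X m)]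

/-- Tensor product of a family of unitaries. -/
noncomputable def tensorUnitary (U : ∀ m, unitaryGroup (X m) ℂ) :
    unitaryGroup (∀ m, X m) ℂ :=
  ⟨tensorFamily fun m => (U m : Matrix (X m) (X m) ℂ), by
    rw [mem_unitaryGroup_iff, star_eq_conjTranspose, tensorFamily_conjTranspose, tensorFamily_mul]
    simp only [self_mul_conjTranspose_of_unitary, tensorFamily_one]⟩

theorem tensorFamily_spectralMatrix (U : ∀ m, unitaryGroup (X m) ℂ) (d : ∀ m, X m → ℝ) :
    tensorFamily (fun m => spectralMatrix (U m) (d m)) =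
      spectralMatrix (tensorUnitary U) fun x => ∏ m, d m (x m) := by
  simp only [spectralMatrix, tensorUnitary, ← tensorFamily_mul, ← tensorFamily_conjTranspose,
    tensorFamily_diagonal, Complex.ofReal_prod]

theorem tensorFamily_update_spectralMatrix (U : ∀ m, unitaryGroup (X m) ℂ) (m : ι)
    (h : X m → ℝ) :
    tensorFamily (Function.update (fun l => (1 : Matrix (X l) (X l) ℂ)) m
        (spectralMatrix (U m) h)) =
      spectralMatrix (tensorUnitary U) fun x => h (x m) := by
  have hupd : Function.update (fun l => (1 : Matrix (X l) (X l) ℂ)) m (spectralMatrix (U m) h) =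
      fun l => spectralMatrix (U l) (Function.update (fun l (_ : X l) => (1 : ℝ)) m h l) := by
    funext l
    by_cases hl : l = m
    · subst hl
      simp
    · rw [Function.update_of_ne hl, Function.update_of_ne hl, spectralMatrix_const]
      simp
  rw [hupd, tensorFamily_spectralMatrix]
  congr 1
  funext x
  rw [Finset.prod_eq_single m]
  · simp
  · intro l _ hl
    rw [Function.update_of_ne hl]
  · simp

end TensorFamily

/-! ### Kronecker products -/

section Kronecker

variable {X Y : Type*} [Fintype X] [DecidableEq X] [Fintype Y] [DecidableEq Y]

/-- Tensor product of two unitaries. -/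
noncomputable def kroneckerUnitary (U : unitaryGroup X ℂ) (V : unitaryGroup Y ℂ) :
    unitaryGroup (X × Y) ℂ :=
  ⟨(U : Matrix X X ℂ) ⊗ₖ (V : Matrix Y Y ℂ), kronecker_mem_unitary U.2 V.2⟩

theorem spectralMatrix_kronecker (U : unitaryGroup X ℂ) (V : unitaryGroup Y ℂ)
    (d : X → ℝ) (e : Y → ℝ) :
    spectralMatrix U d ⊗ₖ spectralMatrix V e =
      spectralMatrix (kroneckerUnitary U V) fun x => d x.1 * e x.2 := by
  simp only [spectralMatrix, kroneckerUnitary, mul_kronecker_mul, conjTranspose_kronecker,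
    diagonal_kronecker_diagonal, Complex.ofReal_mul]

theorem spectralMatrix_kronecker_one (U : unitaryGroup X ℂ) (V : unitaryGroup Y ℂ) (d : X → ℝ) :
    spectralMatrix U d ⊗ₖ (1 : Matrix Y Y ℂ) =
      spectralMatrix (kroneckerUnitary U V) fun x => d x.1 := by
  have h := spectralMatrix_kronecker U V d fun _ => 1
  simpa [spectralMatrix_const V] using h

theorem one_kronecker_spectralMatrix (U : unitaryGroup X ℂ) (V : unitaryGroup Y ℂ) (e : Y → ℝ) :
    (1 : Matrix X X ℂ) ⊗ₖ spectralMatrix V e =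
      spectralMatrix (kroneckerUnitary U V) fun x => e x.2 := by
  have h := spectralMatrix_kronecker U V (fun _ => 1) e
  simpa [spectralMatrix_const U] using h

end Kronecker

/-! ### Canonical states -/

section Thermal

variable {X : Type*} [Fintype X] [DecidableEq X]

theorem exp_spectralMatrix (U : unitaryGroup X ℂ) (d : X → ℝ) :
    NormedSpace.exp (spectralMatrix U d) = spectralMatrix U fun x => Real.exp (d x) := by
  have hinv : (U : Matrix X X ℂ)ᴴ = (U : Matrix X X ℂ)⁻¹ :=
    (inv_eq_right_inv (self_mul_conjTranspose_of_unitary U)).symm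
  have hU : IsUnit (U : Matrix X X ℂ) :=
    IsUnit.of_mul_eq_one _ (self_mul_conjTranspose_of_unitary U)
  rw [spectralMatrix, spectralMatrix, hinv, Matrix.exp_conj _ _ hU, Matrix.exp_diagonal]
  congr 3
  funext x
  rw [Pi.coe_exp, ← Complex.exp_eq_exp_ℂ, Complex.ofReal_exp]

/-- In an eigenbasis of the Hamiltonian the canonical state is a nonsingular probability
distribution `p`, and `-log p = H / (kB T) + log Z`. -/
theorem exists_canonicalState_eq_spectralMatrix [Nonempty X] (kB T : ℝ) {H : Matrix X X ℂ}
    (hH : H.IsHermitian) :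
    ∃ (U : unitaryGroup X ℂ) (h p : X → ℝ), H = spectralMatrix U h ∧
      canonicalState kB T H = spectralMatrix U p ∧ (∀ x, 0 < p x) ∧ ∑ x, p x = 1 ∧
      ∀ x, -Real.log (p x) = (kB * T)⁻¹ * h x + Real.log (partitionFn kB T H) := by
  obtain ⟨U, h, rfl⟩ := exists_eq_spectralMatrix hH
  have hb : boltzmann kB T (spectralMatrix U h) =
      spectralMatrix U fun x => Real.exp (-(kB * T)⁻¹ * h x) := by
    rw [boltzmann, spectralMatrix_smul, exp_spectralMatrix]
  have hZ : partitionFn kB T (spectralMatrix U h) = ∑ x, Real.exp (-(kB * T)⁻¹ * h x) := by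
    rw [partitionFn, hb, trace_spectralMatrix, Complex.ofReal_re]
  have hZ0 : 0 < partitionFn kB T (spectralMatrix U h) := by
    rw [hZ]
    exact Finset.sum_pos (fun x _ => Real.exp_pos _) Finset.univ_nonempty
  refine ⟨U, h, fun x => (partitionFn kB T (spectralMatrix U h))⁻¹ *
    Real.exp (-(kB * T)⁻¹ * h x), rfl, ?_, fun x => by positivity, ?_, fun x => ?_⟩
  · rw [canonicalState, hb, spectralMatrix_smul]
  · rw [← Finset.mul_sum, ← hZ, inv_mul_cancel₀ hZ0.ne']
  · rw [Real.log_mul (inv_ne_zero hZ0.ne') (Real.exp_ne_zero _), Real.log_inv, Real.log_exp]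
    ring

/-- The product of the canonical states of the system and of the baths is nonsingular, and minus
its logarithm is the sum of the Hamiltonians divided by `kB` times the respective temperatures,
up to the constant that is made of the logarithms of the partition functions. -/
theorem exists_initialState_eq_spectralMatrix {n : ℕ} {S : Type*} {B : Fin n → Type*}
    [Fintype S] [DecidableEq S] [Nonempty S] [∀ m, Fintype (B m)] [∀ m, DecidableEq (B m)]
    [∀ m, Nonempty (B m)] (kB T : ℝ) (Tb : Fin n → ℝ) {HS : Matrix S S ℂ}
    (hS : HS.IsHermitian) {HB : ∀ m, Matrix (B m) (B m) ℂ} (hB : ∀ m, (HB m).IsHermitian) :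
    ∃ (W : unitaryGroup (S × ∀ m, B m) ℂ) (p : (S × ∀ m, B m) → ℝ),
      initialState kB T Tb HS HB = spectralMatrix W p ∧ (∀ x, 0 < p x) ∧ ∑ x, p x = 1 ∧
      spectralMatrix W (fun x => -Real.log (p x)) =
        (((kB * T)⁻¹ : ℝ) : ℂ) • (HS ⊗ₖ (1 : Matrix (∀ m, B m) (∀ m, B m) ℂ)) +
        ∑ m, (((kB * Tb m)⁻¹ : ℝ) : ℂ) • ((1 : Matrix S S ℂ) ⊗ₖ
          tensorFamily (Function.update (fun l => (1 : Matrix (B l) (B l) ℂ)) m (HB m))) +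
        ((Real.log (partitionFn kB T HS) +
          ∑ m, Real.log (partitionFn kB (Tb m) (HB m)) : ℝ) : ℂ) • 1 := by
  obtain ⟨U, h, p, hH, hp, hp0, hp1, hlog⟩ := exists_canonicalState_eq_spectralMatrix kB T hS
  choose V g r hG hr hr0 hr1 hrlog using
    fun m => exists_canonicalState_eq_spectralMatrix kB (Tb m) (hB m)
  refine ⟨kroneckerUnitary U (tensorUnitary V), fun x => p x.1 * ∏ m, r m (x.2 m), ?_,
    fun x => mul_pos (hp0 _) (Finset.prod_pos fun m _ => hr0 m _), ?_, ?_⟩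
  · simp only [initialState, hp, hr, tensorFamily_spectralMatrix, spectralMatrix_kronecker]
  · rw [Fintype.sum_prod_type]
    simp only [← Finset.mul_sum, ← Fintype.prod_sum, hr1, Finset.prod_const_one, mul_one, hp1]
  · have hS' : HS ⊗ₖ (1 : Matrix (∀ m, B m) (∀ m, B m) ℂ) =
        spectralMatrix (kroneckerUnitary U (tensorUnitary V)) fun x => h x.1 := by
      conv_lhs => rw [hH]
      exact spectralMatrix_kronecker_one U (tensorUnitary V) h
    have hB' : ∀ m, (1 : Matrix S S ℂ) ⊗ₖ
          tensorFamily (Function.update (fun l => (1 : Matrix (B l) (B l) ℂ)) m (HB m)) =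
        spectralMatrix (kroneckerUnitary U (tensorUnitary V)) fun x => g m (x.2 m) := by
      intro m
      conv_lhs => rw [hG m]
      rw [tensorFamily_update_spectralMatrix, one_kronecker_spectralMatrix]
    simp only [hS', hB']
    rw [← spectralMatrix_const (kroneckerUnitary U (tensorUnitary V))]
    simp only [spectralMatrix_smul, spectralMatrix_sum, spectralMatrix_add]
    congr 1
    funext x
    rw [Real.log_mul (hp0 _).ne' (Finset.prod_pos fun m _ => hr0 m _).ne',
      Real.log_prod fun m _ => (hr0 m _).ne', neg_add, hlog, ← Finset.sum_neg_distrib]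
    simp only [hrlog, Finset.sum_add_distrib]
    ring

end Thermal

/-! ### Linearity of the energy -/

section Energy

variable {X : Type*} [Fintype X]

theorem energy_add (ρ G H : Matrix X X ℂ) : energy ρ (G + H) = energy ρ G + energy ρ H := by
  simp [energy, mul_add]

theorem energy_smul (ρ : Matrix X X ℂ) (c : ℝ) (H : Matrix X X ℂ) :
    energy ρ ((c : ℂ) • H) = c * energy ρ H := by
  simp [energy]

theorem energy_sum {ι : Type*} (s : Finset ι) (ρ : Matrix X X ℂ) (H : ι → Matrix X X ℂ) :
    energy ρ (∑ i ∈ s, H i) = ∑ i ∈ s, energy ρ (H i) := by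
  simp [energy, Finset.mul_sum, trace_sum]

theorem energy_sub_left (ρ σ H : Matrix X X ℂ) : energy (ρ - σ) H = energy ρ H - energy σ H := by
  simp [energy, sub_mul]

theorem energy_one [DecidableEq X] {ρ : Matrix X X ℂ} (htr : ρ.trace = 1) :
    energy ρ 1 = 1 := by
  simp [energy, htr]

end Energy

/-! ### Pure states and their marginals -/

section PureStates

variable {X Y : Type*}

theorem posSemidef_ketbra [Finite X] (v : X → ℂ) : (ketbra v).PosSemidef :=
  posSemidef_vecMulVec_self_star v

theorem ketbra_smul (c : ℂ) (v : X → ℂ) : ketbra (c • v) = (c * star c) • ketbra v := by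
  ext x y
  simp [ketbra, vecMulVec_apply]
  ring

theorem trace_ketbra [Fintype X] (v : X → ℂ) : (ketbra v).trace = star v ⬝ᵥ v := by
  rw [ketbra, trace_vecMulVec, dotProduct_comm]

theorem trace_traceSnd [Fintype X] [Fintype Y] (M : Matrix (X × Y) (X × Y) ℂ) :
    (traceSnd M).trace = M.trace := by
  simp [trace, traceSnd, Fintype.sum_prod_type]

theorem traceSnd_smul [Fintype Y] (c : ℂ) (M : Matrix (X × Y) (X × Y) ℂ) :
    traceSnd (c • M) = c • traceSnd M := by
  ext x y
  simp [traceSnd, Finset.mul_sum]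

theorem traceSnd_sum [Fintype Y] {ι : Type*} (s : Finset ι)
    (M : ι → Matrix (X × Y) (X × Y) ℂ) :
    traceSnd (∑ i ∈ s, M i) = ∑ i ∈ s, traceSnd (M i) := by
  ext x y
  simp only [traceSnd, of_apply, Matrix.sum_apply]
  exact Finset.sum_comm

theorem posSemidef_traceSnd_ketbra [Finite X] [Fintype Y] (v : X × Y → ℂ) :
    (traceSnd (ketbra v)).PosSemidef := by
  have h : traceSnd (ketbra v) = ∑ y, ketbra fun x => v (x, y) := by
    ext x x'
    simp [traceSnd, ketbra, vecMulVec_apply, Matrix.sum_apply]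
  rw [h]
  exact posSemidef_sum _ fun y _ => posSemidef_ketbra _

theorem entanglementEntropy_nonneg [Fintype X] [DecidableEq X] [Fintype Y] {φ : X × Y → ℂ}
    (hφ : star φ ⬝ᵥ φ = 1) : 0 ≤ entanglementEntropy φ :=
  entropy_nonneg (posSemidef_traceSnd_ketbra φ) (by rw [trace_traceSnd, trace_ketbra, hφ])

/-- The squared norm of a vector is a real number. -/
theorem coe_re_dotProduct_star_self [Fintype X] (v : X → ℂ) :
    (((star v ⬝ᵥ v).re : ℝ) : ℂ) = star v ⬝ᵥ v :=
  Complex.ext rfl (Complex.nonneg_iff.mp (dotProduct_star_self_nonneg v)).2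

/-- Normalization of a vector; for the zero vector, the given unit vector `e` serves. -/
theorem exists_unit_ketbra_eq [Fintype X] {e : X → ℂ} (he : star e ⬝ᵥ e = 1) (v : X → ℂ) :
    ∃ φ : X → ℂ, star φ ⬝ᵥ φ = 1 ∧
      ketbra v = (((star v ⬝ᵥ v).re : ℝ) : ℂ) • ketbra φ := by
  have hq0 : 0 ≤ (star v ⬝ᵥ v).re := (Complex.nonneg_iff.mp (dotProduct_star_self_nonneg v)).1
  have hqv := coe_re_dotProduct_star_self v
  generalize (star v ⬝ᵥ v).re = q at hq0 hqv
  rcases hq0.eq_or_lt with rfl | hq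
  · refine ⟨e, he, ?_⟩
    have hv : v = 0 := by
      rw [← dotProduct_star_self_eq_zero, ← hqv, Complex.ofReal_zero]
    simp [hv, ketbra]
  · have hs : (Real.sqrt q : ℂ) * (Real.sqrt q : ℂ) = q := by
      rw [← Complex.ofReal_mul, Real.mul_self_sqrt hq.le]
    have hs0 : (Real.sqrt q : ℂ) ≠ 0 := by
      exact_mod_cast (Real.sqrt_pos.mpr hq).ne'
    have hstar : star ((Real.sqrt q : ℂ)⁻¹) = (Real.sqrt q : ℂ)⁻¹ := by
      rw [← Complex.ofReal_inv]
      exact Complex.conj_ofReal _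
    refine ⟨(Real.sqrt q : ℂ)⁻¹ • v, ?_, ?_⟩
    · rw [star_smul, smul_dotProduct, dotProduct_smul, ← hqv, hstar, ← hs]
      simp only [smul_eq_mul]
      field_simp
    · rw [ketbra_smul, smul_smul, hstar, ← hs]
      rw [show (Real.sqrt q : ℂ) * (Real.sqrt q : ℂ) * ((Real.sqrt q : ℂ)⁻¹ *
        (Real.sqrt q : ℂ)⁻¹) = 1 by field_simp, one_smul]

theorem dotProduct_ketbra_mulVec [Fintype X] (w v : X → ℂ) :
    star w ⬝ᵥ (ketbra v *ᵥ w) = ((Complex.normSq (star w ⬝ᵥ v) : ℝ) : ℂ) := by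
  rw [ketbra, vecMulVec_mulVec, dotProduct_smul, ← Complex.mul_conj]
  rw [← Complex.star_def, ← star_dotProduct, op_smul_eq_smul, smul_eq_mul, mul_comm]

/-- A pure state is extreme: every component of a decomposition of it with positive weight is that
pure state. The part of the component that is orthogonal to the pure state has expectation zero in
each term. -/
theorem ketbra_eq_of_decomposition [Fintype X] {J : Type*} (s : Finset J) {ψ : X → ℂ}
    (hψ : star ψ ⬝ᵥ ψ = 1) {q : J → ℝ} {φ : J → X → ℂ} (hq : ∀ j ∈ s, 0 ≤ q j)
    (hφ : ∀ j, star (φ j) ⬝ᵥ φ j = 1) (hdec : ketbra ψ = ∑ j ∈ s, (q j : ℂ) • ketbra (φ j))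
    {j : J} (hj : j ∈ s) (hqj : 0 < q j) : ketbra (φ j) = ketbra ψ := by
  set c := star ψ ⬝ᵥ φ j with hc
  set w := φ j - c • ψ with hw
  have hψw : star ψ ⬝ᵥ w = 0 := by
    rw [hw, dotProduct_sub, dotProduct_smul, hψ, ← hc]
    simp
  have hwψ : star w ⬝ᵥ ψ = 0 := by
    rw [star_dotProduct, hψw, star_zero]
  have hsum : ∑ i ∈ s, q i * Complex.normSq (star w ⬝ᵥ φ i) = 0 := by
    have h := dotProduct_ketbra_mulVec w ψ
    rw [hwψ, hdec, sum_mulVec, dotProduct_sum] at h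
    simp only [smul_mulVec, dotProduct_smul, dotProduct_ketbra_mulVec, smul_eq_mul] at h
    simp only [map_zero, Complex.ofReal_zero] at h
    exact_mod_cast h
  have hwφ : star w ⬝ᵥ φ j = 0 := by
    have h := (Finset.sum_eq_zero_iff_of_nonneg fun i hi =>
      mul_nonneg (hq i hi) (Complex.normSq_nonneg _)).mp hsum j hj
    exact Complex.normSq_eq_zero.mp ((mul_eq_zero.mp h).resolve_left hqj.ne')
  have hw0 : w = 0 := by
    rw [← dotProduct_star_self_eq_zero]
    have : star w ⬝ᵥ w = star w ⬝ᵥ φ j - c • (star w ⬝ᵥ ψ) := by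
      rw [← dotProduct_smul, ← dotProduct_sub]
    rw [this, hwφ, hwψ]
    simp
  have hφc : φ j = c • ψ := sub_eq_zero.mp hw0
  have hcc : c * star c = 1 := by
    have h := hφ j
    rw [hφc, star_smul, smul_dotProduct, dotProduct_smul, hψ] at h
    simpa [mul_comm] using h
  rw [hφc, ketbra_smul, hcc, one_smul]

end PureStates

/-! ### Bounds on the entanglement of formation -/

section EntanglementOfFormation

variable {X Y : Type*} [Fintype X] [DecidableEq X] [Fintype Y]

/-- The entanglement of formation of a pure state is at least its entanglement entropy, since all
decompositions of a pure state are trivial. -/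
theorem entropy_le_entanglementOfFormation_ketbra {ψ : X × Y → ℂ} (hψ : star ψ ⬝ᵥ ψ = 1) :
    entropy (traceSnd (ketbra ψ)) ≤ entanglementOfFormation (ketbra ψ) := by
  refine le_csInf ⟨entanglementEntropy ψ, 1, fun _ => 1, fun _ => ψ, by simp, by simp,
    fun _ => hψ, by simp, by simp⟩ ?_
  rintro e ⟨N, q, φ, hq, hq1, hφ, hdec, rfl⟩
  refine le_of_eq ?_
  calc entropy (traceSnd (ketbra ψ)) = ∑ j, q j * entropy (traceSnd (ketbra ψ)) := by
        rw [← Finset.sum_mul, hq1, one_mul]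
    _ = ∑ j, q j * entanglementEntropy (φ j) := by
        refine Finset.sum_congr rfl fun j _ => ?_
        rcases (hq j).eq_or_lt with h0 | hpos
        · simp [← h0]
        · rw [entanglementEntropy, ketbra_eq_of_decomposition Finset.univ hψ (fun i _ => hq i) hφ
            hdec (Finset.mem_univ j) hpos]

theorem entanglementOfFormation_le {J : Type*} [Fintype J] {ρ : Matrix (X × Y) (X × Y) ℂ}
    {q : J → ℝ} {φ : J → X × Y → ℂ} (hq : ∀ j, 0 ≤ q j) (hq1 : ∑ j, q j = 1)
    (hφ : ∀ j, star (φ j) ⬝ᵥ φ j = 1) (hdec : ρ = ∑ j, (q j : ℂ) • ketbra (φ j)) :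
    entanglementOfFormation ρ ≤ ∑ j, q j * entanglementEntropy (φ j) := by
  refine csInf_le ⟨0, ?_⟩ ?_
  · rintro e ⟨N, q, φ, hq, -, hφ, -, rfl⟩
    exact Finset.sum_nonneg fun j _ => mul_nonneg (hq j) (entanglementEntropy_nonneg (hφ j))
  · let ε := (Fintype.equivFin J).symm
    refine ⟨Fintype.card J, q ∘ ε, φ ∘ ε, fun j => hq _, ?_, fun j => hφ _, ?_, ?_⟩
    · rw [← hq1]
      exact ε.sum_comp q
    · rw [hdec]
      exact (ε.sum_comp fun j => (q j : ℂ) • ketbra (φ j)).symm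
    · exact (ε.sum_comp fun j => q j * entanglementEntropy (φ j)).symm

end EntanglementOfFormation

/-! ### Information thermodynamic processes -/

namespace InfoProcess

variable {n : ℕ} {S P R : Type*} {B : Fin n → Type*} {K : Type*} {L : K → Type*}
  [Fintype S] [DecidableEq S] [Fintype P] [DecidableEq P] [Fintype R] [DecidableEq R]
  [∀ m, Fintype (B m)] [∀ m, DecidableEq (B m)] [Fintype K] [∀ k, Fintype (L k)]
  (pr : InfoProcess n S P R B K L)

theorem sum_basis_mul_star (p p' : P) :
    ∑ b, pr.basis b p * star (pr.basis b p') = if p' = p then 1 else 0 := by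
  have h := pr.basis.sum_inner_mul_inner (EuclideanSpace.single p (1 : ℂ))
    (EuclideanSpace.single p' (1 : ℂ))
  simpa [EuclideanSpace.inner_single_left, EuclideanSpace.inner_single_right] using h

/-- The post-measurement vectors decompose the state of `S B R` after the interaction, since the
probe can be traced out in the measured basis. -/
theorem rhoSBR_eq_sum_ketbra :
    pr.rhoSBR = ∑ b : Σ k, L k, ketbra (pr.postVector b.1 b.2) := by
  ext x y
  simp only [rhoSBR, of_apply, Matrix.sum_apply, ketbra, vecMulVec_apply, Pi.star_apply,
    postVector]
  set f := fun p => pr.psiPSBR (((p, x.1.1), x.1.2), x.2)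
  set g := fun p => pr.psiPSBR (((p, y.1.1), y.1.2), y.2)
  calc ∑ p, f p * star (g p)
      = ∑ p, ∑ p', (∑ b, pr.basis b p' * star (pr.basis b p)) * (f p * star (g p')) := by
        simp only [sum_basis_mul_star, ite_mul, one_mul, zero_mul, Finset.sum_ite_eq,
          Finset.mem_univ, if_true]
    _ = ∑ p, ∑ b, ∑ p', star (pr.basis b p) * f p * (pr.basis b p' * star (g p')) := by
        refine Finset.sum_congr rfl fun p _ => ?_
        rw [Finset.sum_comm]
        refine Finset.sum_congr rfl fun p' _ => ?_
        rw [Finset.sum_mul]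
        exact Finset.sum_congr rfl fun b _ => by ring
    _ = _ := by
        rw [Finset.sum_comm]
        refine Finset.sum_congr rfl fun b _ => ?_
        simp only [star_sum, star_mul', star_star, Finset.sum_mul_sum]
        rfl

variable [Nonempty S] [∀ m, Nonempty (B m)]

theorem trace_rhoI : pr.rhoI.trace = 1 := by
  obtain ⟨W, p, hW, -, hp1, -⟩ :=
    exists_initialState_eq_spectralMatrix pr.kB pr.T pr.Tb pr.HSi_herm pr.HB_herm
  rw [rhoI, hW, trace_spectralMatrix, hp1, Complex.ofReal_one]

theorem purification_unit : star pr.ψ ⬝ᵥ pr.ψ = 1 := by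
  rw [← trace_ketbra, ← trace_traceSnd, pr.purifies, trace_mul_comm, ← mul_assoc,
    conjTranspose_mul_self_of_unitary, one_mul]
  exact pr.trace_rhoI

theorem psiPSBR_unit : star pr.psiPSBR ⬝ᵥ pr.psiPSBR = 1 := by
  have hU : (((pr.USP : Matrix (P × S) (P × S) ℂ) ⊗ₖ
      (1 : Matrix (∀ m, B m) (∀ m, B m) ℂ)) ⊗ₖ (1 : Matrix R R ℂ))ᴴ *
      (((pr.USP : Matrix (P × S) (P × S) ℂ) ⊗ₖ
      (1 : Matrix (∀ m, B m) (∀ m, B m) ℂ)) ⊗ₖ (1 : Matrix R R ℂ)) = 1 := by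
    simp only [conjTranspose_kronecker, ← mul_kronecker_mul, conjTranspose_mul_self_of_unitary,
      conjTranspose_one, mul_one, one_kronecker_one]
  rw [psiPSBR, star_mulVec, dotProduct_mulVec, vecMul_vecMul, hU, vecMul_one]
  have h1 := pr.probe_unit
  have h2 := pr.purification_unit
  simp only [dotProduct, Pi.star_apply, Fintype.sum_prod_type, star_mul'] at h1 h2 ⊢
  refine Eq.trans ?_ h1
  refine Finset.sum_congr rfl fun p _ => ?_
  rw [← mul_one (star (pr.probe p) * pr.probe p), ← h2]
  simp only [Finset.mul_sum]
  refine Finset.sum_congr rfl fun s _ => Finset.sum_congr rfl fun b _ =>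
    Finset.sum_congr rfl fun r _ => ?_
  ring

theorem trace_rhoSBR : pr.rhoSBR.trace = 1 := by
  rw [← pr.psiPSBR_unit, trace]
  simp only [diag_apply, rhoSBR, of_apply]
  rw [Finset.sum_comm]
  simp only [ketbra, vecMulVec_apply, dotProduct, Pi.star_apply, Fintype.sum_prod_type, mul_comm]

/-- The state of `S B` after the feedback is a mixture of states that differ by unitaries from
the marginals of the members of one pure-state decomposition of the state of `S B R`. -/
theorem exists_mixture :
    ∃ (q : (Σ k, L k) → ℝ) (φ : (Σ k, L k) → (S × ∀ m, B m) × R → ℂ),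
      (∀ b, 0 ≤ q b) ∧ ∑ b, q b = 1 ∧ (∀ b, star (φ b) ⬝ᵥ φ b = 1) ∧
      pr.rhoSBR = ∑ b, (q b : ℂ) • ketbra (φ b) ∧
      pr.rho3 = ∑ b : Σ k, L k, (q b : ℂ) •
        ((pr.Ufb b.1 : Matrix (S × ∀ m, B m) (S × ∀ m, B m) ℂ) * traceSnd (ketbra (φ b)) *
          (pr.Ufb b.1 : Matrix (S × ∀ m, B m) (S × ∀ m, B m) ℂ)ᴴ) := by
  choose φ hφ hv using fun b : Σ k, L k =>
    exists_unit_ketbra_eq pr.purification_unit (pr.postVector b.1 b.2)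
  have hdec := pr.rhoSBR_eq_sum_ketbra
  refine ⟨fun b => (star (pr.postVector b.1 b.2) ⬝ᵥ pr.postVector b.1 b.2).re, φ,
    fun b => (Complex.nonneg_iff.mp (dotProduct_star_self_nonneg _)).1, ?_, hφ, ?_, ?_⟩
  · have h := congrArg trace hdec
    rw [trace_rhoSBR, trace_sum] at h
    simp only [trace_ketbra] at h
    rw [← Complex.re_sum, ← h, Complex.one_re]
  · rw [hdec]
    exact Finset.sum_congr rfl fun b _ => hv b
  · rw [rho3, Fintype.sum_sigma]
    refine Finset.sum_congr rfl fun k _ => ?_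
    rw [weightedPostState, traceSnd_sum, Finset.mul_sum, Finset.sum_mul]
    refine Finset.sum_congr rfl fun i _ => ?_
    rw [hv ⟨k, i⟩, traceSnd_smul, mul_smul_comm, smul_mul_assoc]

theorem posSemidef_rho3 : pr.rho3.PosSemidef := by
  obtain ⟨q, φ, hq, -, -, -, h3⟩ := pr.exists_mixture
  rw [h3]
  exact posSemidef_sum _ fun b _ =>
    ((posSemidef_traceSnd_ketbra (φ b)).mul_mul_conjTranspose_same _).smul
      (show (0 : ℂ) ≤ (q b : ℂ) by exact_mod_cast hq b)

theorem trace_rho3 : pr.rho3.trace = 1 := by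
  obtain ⟨q, φ, -, hq1, hφ, -, h3⟩ := pr.exists_mixture
  rw [h3, trace_sum]
  have h : ∀ b : Σ k, L k, ((q b : ℂ) •
      ((pr.Ufb b.1 : Matrix (S × ∀ m, B m) (S × ∀ m, B m) ℂ) * traceSnd (ketbra (φ b)) *
        (pr.Ufb b.1 : Matrix (S × ∀ m, B m) (S × ∀ m, B m) ℂ)ᴴ)).trace = q b := by
    intro b
    rw [trace_smul, trace_mul_comm, ← mul_assoc, conjTranspose_mul_self_of_unitary, one_mul,
      trace_traceSnd, trace_ketbra, hφ, smul_eq_mul, mul_one]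
  simp only [h]
  exact_mod_cast hq1

theorem posSemidef_rhoF : pr.rhoF.PosSemidef :=
  pr.posSemidef_rho3.mul_mul_conjTranspose_same _

theorem trace_rhoF : pr.rhoF.trace = 1 := by
  rw [rhoF, trace_mul_comm, ← mul_assoc, conjTranspose_mul_self_of_unitary, one_mul, trace_rho3]

/-- The measured decomposition is a candidate in the entanglement of formation, and by concavity
its average entanglement entropy is at most the entropy of the state after the feedback. -/
theorem entanglementOfFormation_rhoSBR_le :
    entanglementOfFormation pr.rhoSBR ≤ entropy pr.rhoF := by
  rw [rhoF, entropy_unitary_conj pr.posSemidef_rho3.1]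
  obtain ⟨q, φ, hq, hq1, hφ, hdec, h3⟩ := pr.exists_mixture
  refine (entanglementOfFormation_le hq hq1 hφ hdec).trans ?_
  rw [h3]
  refine le_trans (le_of_eq (Finset.sum_congr rfl fun b _ => ?_))
    (sum_mul_entropy_le_entropy_sum Finset.univ (fun b _ => hq b) hq1 fun b =>
      (posSemidef_traceSnd_ketbra (φ b)).mul_mul_conjTranspose_same
        (pr.Ufb b.1 : Matrix (S × ∀ m, B m) (S × ∀ m, B m) ℂ))
  rw [entropy_unitary_conj (posSemidef_traceSnd_ketbra (φ b)).1, entanglementEntropy]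

theorem entropy_rhoI_le : entropy pr.rhoI ≤ entanglementOfFormation (ketbra pr.ψ) := by
  refine le_trans (le_of_eq ?_) (entropy_le_entanglementOfFormation_ketbra pr.purification_unit)
  obtain ⟨W, p, hW, -⟩ :=
    exists_initialState_eq_spectralMatrix pr.kB pr.T pr.Tb pr.HSi_herm pr.HB_herm
  have hI : pr.rhoI.IsHermitian := by
    rw [rhoI, hW]
    exact spectralMatrix_isHermitian W p
  rw [pr.purifies]
  exact (entropy_unitary_conj hI pr.Uinit).symm

/-- The entanglement information bounds the decrease of the entropy of `S B`. -/
theorem entropy_sub_entropy_le_IE : entropy pr.rhoI - entropy pr.rhoF ≤ pr.IE :=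
  sub_le_sub pr.entropy_rhoI_le pr.entanglementOfFormation_rhoSBR_le

theorem entropy_rhoI_eq :
    entropy pr.rhoI = (pr.kB * pr.T)⁻¹ * pr.Ui +
      ∑ m, (pr.kB * pr.Tb m)⁻¹ * energy pr.rhoI (pr.bathHamiltonian m) +
      (Real.log (partitionFn pr.kB pr.T pr.HSi) +
        ∑ m, Real.log (partitionFn pr.kB (pr.Tb m) (pr.HB m))) := by
  obtain ⟨W, p, hW, -, -, hlog⟩ :=
    exists_initialState_eq_spectralMatrix pr.kB pr.T pr.Tb pr.HSi_herm pr.HB_herm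
  have h := entropy_spectralMatrix_eq_energy_neg_log W p
  rw [hlog, ← hW, energy_add, energy_add, energy_sum, energy_smul, energy_smul] at h
  simp only [energy_smul] at h
  rw [show initialState pr.kB pr.T pr.Tb pr.HSi pr.HB = pr.rhoI from rfl,
    energy_one pr.trace_rhoI, mul_one] at h
  exact h

/-- Klein's inequality for the final state, relative to the product of the canonical states at
the final temperatures. -/
theorem entropy_rhoF_le :
    entropy pr.rhoF ≤ (pr.kB * pr.T')⁻¹ * pr.Uf +
      ∑ m, (pr.kB * pr.Tb m)⁻¹ * energy pr.rhoF (pr.bathHamiltonian m) +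
      (Real.log (partitionFn pr.kB pr.T' pr.HSf) +
        ∑ m, Real.log (partitionFn pr.kB (pr.Tb m) (pr.HB m))) := by
  obtain ⟨W, p, -, hp, hp1, hlog⟩ :=
    exists_initialState_eq_spectralMatrix pr.kB pr.T' pr.Tb pr.HSf_herm pr.HB_herm
  have h := entropy_le_energy_neg_log pr.posSemidef_rhoF pr.trace_rhoF W hp hp1
  rw [hlog, energy_add, energy_add, energy_sum, energy_smul, energy_smul] at h
  simp only [energy_smul] at h
  rw [energy_one pr.trace_rhoF, mul_one] at h
  exact h

theorem sub_freeEnergy_div {X : Type*} [Fintype X] [DecidableEq X] {kB T : ℝ} (hk : 0 < kB)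
    (hT : 0 < T) (U : ℝ) (H : Matrix X X ℂ) :
    (U - freeEnergy kB T H) / T =
      kB * ((kB * T)⁻¹ * U + Real.log (partitionFn kB T H)) := by
  rw [freeEnergy]
  field_simp
  ring

/-- The generalized second law with entanglement information. -/
theorem second_law :
    (pr.Ui - pr.Fi) / pr.T + ∑ m, pr.Q m / pr.Tb m ≤
      (pr.Uf - pr.Ff) / pr.T' + pr.kB * pr.IE := by
  have hk := pr.kB_pos
  have hQ : ∑ m, pr.Q m / pr.Tb m =
      pr.kB * (∑ m, (pr.kB * pr.Tb m)⁻¹ * energy pr.rhoI (pr.bathHamiltonian m) -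
        ∑ m, (pr.kB * pr.Tb m)⁻¹ * energy pr.rhoF (pr.bathHamiltonian m)) := by
    rw [← Finset.sum_sub_distrib, Finset.mul_sum]
    refine Finset.sum_congr rfl fun m _ => ?_
    have := pr.Tb_pos m
    rw [Q, energy_sub_left]
    field_simp
  rw [Fi, Ff, sub_freeEnergy_div hk pr.T_pos, sub_freeEnergy_div hk pr.T'_pos, hQ, ← mul_add,
    ← mul_add]
  refine mul_le_mul_of_nonneg_left ?_ hk.le
  linarith [pr.entropy_sub_entropy_le_IE, pr.entropy_rhoI_eq, pr.entropy_rhoF_le]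

end InfoProcess

end InfoThermo

theorem theorem1 {n : ℕ} {S P R : Type*} {B : Fin n → Type*} {K : Type*} {L : K → Type*}
    [Fintype S] [DecidableEq S] [Nonempty S] [Fintype P] [DecidableEq P]
    [Fintype R] [DecidableEq R]
    [∀ m, Fintype (B m)] [∀ m, DecidableEq (B m)] [∀ m, Nonempty (B m)]
    [Fintype K] [∀ k, Fintype (L k)]
    (pr : InfoThermo.InfoProcess n S P R B K L) :
    ((pr.Ui - pr.Fi) / pr.T + ∑ m, pr.Q m / pr.Tb m ≤
        (pr.Uf - pr.Ff) / pr.T' + pr.kB * pr.IE) ∧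
      (n = 1 → pr.T' = pr.T → (∀ m, pr.Tb m = pr.T) →
        pr.Wext ≤ -(pr.Ff - pr.Fi) + pr.kB * pr.T * pr.IE ∧
        -(pr.Ff - pr.Fi) + pr.kB * pr.T * pr.IE =
          -(pr.Ff - pr.Fi) - pr.kB * pr.T * pr.deltaEF) := by
  refine ⟨pr.second_law, fun _ hT' hTb => ⟨?_, ?_⟩⟩
  · have h := pr.second_law
    have hT := pr.T_pos
    simp only [hT', hTb] at h
    rw [← Finset.sum_div, ← add_div, div_le_iff₀ hT, add_mul, div_mul_cancel₀ _ hT.ne'] at h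
    -- The work is the energy that the system loses plus the heat.
    have hW : pr.Wext = pr.Ui - pr.Uf + ∑ m, pr.Q m := by
      simp only [InfoThermo.InfoProcess.Wext, InfoThermo.InfoProcess.Ui,
        InfoThermo.InfoProcess.Uf, InfoThermo.InfoProcess.Q, InfoThermo.energy_add,
        InfoThermo.energy_sum, InfoThermo.energy_sub_left, Finset.sum_sub_distrib]
      ring
    rw [hW]
    linarith
  · rw [InfoThermo.InfoProcess.IE, InfoThermo.InfoProcess.deltaEF]
    ring
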